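/- Let $k$ be a field and $R=k[x_1,\dots,x_n]$ with the standard grading. Let $\Delta$ be a simplicial complex whose vertices are among $x_1,\dots,x_n$ (a family of subsets closed under passing to subsets), with facets its maximal faces. A facet $F$ of a complex is a \emph{leaf} if it is the only facet, or there is a facet $G\neq F$ with $F\cap H\subseteq G$ for all facets $H\ne F$. Assume that $\Delta$ is a \emph{forest}: every complex whose facet set is a nonempty subset of the facet set of $\Delta$ has a leaf (in particular, $\Delta$ may be a \emph{tree}, i.e. a connected forest). The \emph{facet ideal} $\mathcal F(\Delta)\subseteq R$ is generated by the monomials $\prod_{x_i\in F}x_i$, $F$ a facet of $\Delta$. The \emph{cover complex} $\Delta_M$ is the complex whose facets are the minimal vertex covers of $\Delta$, i.e. the minimal sets of vertices that meet every facet of $\Delta$. The \emph{dual} of a square-free monomial ideal $I$ is $I^\vee=\mathcal F(\Gamma_M)$, where $\Gamma$ is the complex with $\mathcal F(\Gamma)=I$, i.e. the complex whose facets are the supports of the minimal monomial generators of $I$; thus $\mathcal F(\Delta)^\vee=\mathcal F(\Delta_M)$. For an integer $j\ge 1$ the \emph{square-free homogeneous component} $I_{[j]}$ is the ideal generated by the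 square-free monomials of degree $j$ in $I$. An ideal $J$ of $R$ has a \emph{linear resolution} if $R/J$ has a minimal graded free resolution $\cdots\to R^{\beta_2}\to R^{\beta_1}\to R^{\beta_0}\to R/J\to 0$ such that for all $j>1$ the nonzero entries of the matrix of $R^{\beta_j}\to R^{\beta_{j-1}}$ are homogeneous of degree $1$. Then $\mathcal F(\Delta)^\vee$ is componentwise linear: for every $j\ge 1$, the ideal $(\mathcal F(\Delta)^\vee)_{[j]}$ has a linear resolution. -/

import Mathlib

open MvPolynomial

namespace FacetTree

universe u v

/-- A simplicial complex with vertices among the elements of `σ`: a family of finite sets closed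
under passing to subsets.  In contrast to Mathlib's `AbstractSimplicialComplex`, the empty set is a
face (of every complex that has a face), and an element of `σ` need not be a vertex, so that
complexes with different vertex sets have their facet ideals in the same polynomial ring. -/
@[ext]
structure SimplicialComplex (σ : Type u) where
  faces : Set (Finset σ)
  down_closed : ∀ ⦃F G : Finset σ⦄, F ∈ faces → G ⊆ F → G ∈ faces

namespace SimplicialComplex

variable {σ : Type u}

/-- The complex `⟨F₁, …, F_q⟩` generated by a family of sets. -/
def generatedBy (S : Set (Finset σ)) : SimplicialComplex σ where
  faces := {F | ∃ G ∈ S, F ⊆ G}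
  down_closed := fun _ _ ⟨H, hH, hFH⟩ hGF => ⟨H, hH, hGF.trans hFH⟩

/-- The facets: the faces that are maximal under inclusion. -/
def facets (Δ : SimplicialComplex σ) : Set (Finset σ) :=
  {F | Maximal (fun G => G ∈ Δ.faces) F}

/-- The vertex set. -/
def vertices (Δ : SimplicialComplex σ) : Set σ :=
  {x | {x} ∈ Δ.faces}

/-- `Γ` is a subcollection of `Δ`: every facet of `Γ` is a facet of `Δ`. -/
def IsSubcollection (Γ Δ : SimplicialComplex σ) : Prop :=
  Γ.facets ⊆ Δ.facets

/-- `F` is a leaf of `Δ`: it is a facet, and either it is the only facet, or there is a facet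
`G ≠ F` that contains the intersection of `F` with every facet other than `F`. -/
def IsLeaf (Δ : SimplicialComplex σ) (F : Finset σ) : Prop :=
  F ∈ Δ.facets ∧
    (Δ.facets = {F} ∨
      ∃ G ∈ Δ.facets, G ≠ F ∧
        ∀ H ∈ Δ.facets, H ≠ F → (F : Set σ) ∩ (H : Set σ) ⊆ (G : Set σ))

/-- `Δ` is a forest: every nonempty subcollection has a leaf. -/
def IsForest (Δ : SimplicialComplex σ) : Prop :=
  ∀ Γ : SimplicialComplex σ, Γ.IsSubcollection Δ → Γ.facets.Nonempty → ∃ F, Γ.IsLeaf F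

/-- `A` is a vertex cover of `Δ`: a set of vertices that meets every facet. -/
def IsVertexCover (Δ : SimplicialComplex σ) (A : Finset σ) : Prop :=
  (A : Set σ) ⊆ Δ.vertices ∧ ∀ F ∈ Δ.facets, ∃ x ∈ A, x ∈ F

/-- The cover complex `Δ_M`: its facets are the minimal vertex covers of `Δ`. -/
def coverComplex (Δ : SimplicialComplex σ) : SimplicialComplex σ :=
  generatedBy {A | Minimal Δ.IsVertexCover A}

end SimplicialComplex

section Ideals

variable {σ : Type u} {k : Type v} [Field k]

variable (k) in
/-- The square-free monomial with support `F`. -/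
noncomputable def squarefreeMonomial (F : Finset σ) : MvPolynomial σ k :=
  ∏ i ∈ F, X i

variable (k) in
/-- The facet ideal of `Δ`, generated by the square-free monomials of the facets. -/
noncomputable def facetIdeal (Δ : SimplicialComplex σ) : Ideal (MvPolynomial σ k) :=
  Ideal.span (squarefreeMonomial k '' Δ.facets)

/-- The facet complex of a square-free monomial ideal `I`.  Its facets are the supports of the
minimal monomial generators of `I`, that is, the minimal sets `F` whose monomial lies in `I`. -/
def facetComplex (I : Ideal (MvPolynomial σ k)) : SimplicialComplex σ :=
  SimplicialComplex.generatedBy {F | Minimal (fun G => squarefreeMonomial k G ∈ I) F}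

/-- The dual `I^∨` of a square-free monomial ideal `I`: the facet ideal of the cover complex of the
facet complex of `I`. -/
noncomputable def dualIdeal (I : Ideal (MvPolynomial σ k)) : Ideal (MvPolynomial σ k) :=
  facetIdeal k (facetComplex I).coverComplex

/-- A minimal graded free resolution of `R ⧸ I`, where `R = k[σ]` has the standard grading.
The `j`-th module is the free `R`-module on the finite basis `ι j`, whose element `a` has degree
`deg j a`; the map from the `(j+1)`-st to the `j`-th module is given by the matrix `d j`; the
augmentation onto `R ⧸ I` sends the basis element `a` to `gen a`. -/
structure MinimalFreeResolution (I : Ideal (MvPolynomial σ k)) where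
  ι : ℕ → Type u
  [fintype : ∀ j, Fintype (ι j)]
  deg : ∀ j, ι j → ℕ
  d : ∀ j, Matrix (ι j) (ι (j + 1)) (MvPolynomial σ k)
  gen : ι 0 → MvPolynomial σ k ⧸ I
  gen_homogeneous : ∀ a, ∃ p : MvPolynomial σ k,
    p.IsHomogeneous (deg 0 a) ∧ Ideal.Quotient.mk I p = gen a
  d_homogeneous : ∀ j a b, d j a b ≠ 0 →
    ∃ n, deg j a + n = deg (j + 1) b ∧ (d j a b).IsHomogeneous n
  surjective : Function.Surjective (Fintype.linearCombination (MvPolynomial σ k) gen)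
  exact_zero : Function.Exact (d 0).mulVecLin (Fintype.linearCombination (MvPolynomial σ k) gen)
  exact_succ : ∀ j, Function.Exact (d (j + 1)).mulVecLin (d j).mulVecLin
  /-- Minimality: all matrix entries lie in the ideal generated by the variables. -/
  minimal : ∀ j a b, d j a b ∈ idealOfVars σ k

/-- `I` has a linear resolution: `R ⧸ I` has a minimal graded free resolution in which all nonzero
entries of the matrices, from the second map on, are homogeneous of degree one. -/
def HasLinearResolution (I : Ideal (MvPolynomial σ k)) : Prop :=
  ∃ P : MinimalFreeResolution I, ∀ j, 1 ≤ j → ∀ a b, P.d j a b ≠ 0 → (P.d j a b).IsHomogeneous 1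

/-- The `j`-th square-free homogeneous component `I_[j]`: the ideal generated by the square-free
monomials of degree `j` in `I`. -/
noncomputable def squarefreeComponent (I : Ideal (MvPolynomial σ k)) (j : ℕ) :
    Ideal (MvPolynomial σ k) :=
  Ideal.span (squarefreeMonomial k '' {F | F.card = j ∧ squarefreeMonomial k F ∈ I})

/-- Componentwise linearity of a square-free monomial ideal. -/
def IsComponentwiseLinear (I : Ideal (MvPolynomial σ k)) : Prop :=
  ∀ j, 0 < j → HasLinearResolution (squarefreeComponent I j)

end Ideals

end FacetTree

/-! A square-free monomial lies in the dual of the facet ideal exactly when its support meets every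
facet, so the component of degree `j` is generated by the vertex covers with `j` elements. The proof
orders these covers so that the generators have linear quotients, and derives a linear resolution
from such an order.

Combinatorics (`IsForestFamily.hasLinearQuotients_covers`): once redundant supersets are dropped, a
leaf `F` has a vertex `v` lying in no other facet. A cover either meets `F \ {v}`, and is then a
cover of the family with `v` deleted, or meets `F` only in `v`, and is then `v` together with a
cover of the remaining facets restricted to the complement of `F`. Both smaller families are
forests. The covers of the first kind come first: given one of them, any `s` it has in `F \ {v}` can
replace `v` in a cover of the second kind.

Algebra (`hasLinearResolution_of_linearStage`): if every colon ideal of a generator by its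
predecessors is generated by variables, each such variable gives a linear syzygy. These generate all
syzygies (`LinearStage.span_range_syz`) and, in lexicographic order, again have colon ideals
generated by variables (`LinearStage.syz_colon`), so the construction iterates. -/

namespace FacetTree

universe u v

/-! ### Linear resolutions from colon ideals generated by variables -/

section LinearStages

variable {σ : Type u} {k : Type v} [Field k]

lemma homogeneousComponent_mul_of_isHomogeneous (n e : ℕ) (c : MvPolynomial σ k)
    {m : MvPolynomial σ k} (hm : m.IsHomogeneous e) :
    homogeneousComponent (n + e) (c * m) = homogeneousComponent n c * m := by
  conv_lhs => rw [← sum_homogeneousComponent c, Finset.sum_mul, map_sum]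
  have h : ∀ i, homogeneousComponent (n + e) (homogeneousComponent i c * m) =
      if i = n then homogeneousComponent n c * m else 0 := by
    intro i
    rw [homogeneousComponent_of_mem
      (((homogeneousComponent_isHomogeneous i c).mul hm : IsHomogeneous _ (i + e)))]
    by_cases hin : i = n
    · simp [hin]
    · rw [if_neg hin, if_neg (by omega)]
  simp_rw [h]
  rw [Finset.sum_ite_eq']
  split_ifs with hn
  · rfl
  · rw [homogeneousComponent_eq_zero, zero_mul]
    simpa using hn

/-- A variable is a nonzerodivisor modulo an ideal generated by other variables. -/
lemma mem_span_X_of_mul_X_mem {T : Set σ} {s : σ} (hs : s ∉ T) {r : MvPolynomial σ k}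
    (h : r * X s ∈ Ideal.span (X '' T : Set (MvPolynomial σ k))) :
    r ∈ Ideal.span (X '' T : Set (MvPolynomial σ k)) := by
  classical
  rw [mem_ideal_span_X_image] at h ⊢
  intro m hm
  obtain ⟨i, hi, hne⟩ := h (m + Finsupp.single s 1) (by
    rw [mem_support_iff, coeff_mul_X]; exact mem_support_iff.mp hm)
  refine ⟨i, hi, ?_⟩
  have : s ≠ i := fun h => hs (h ▸ hi)
  simpa [Finsupp.single_apply, this] using hne

/-- A finite family of homogeneous vectors of degree `e` over `k[σ]`, in a linear order such that
the colon ideal of the span of the smaller vectors by each vector is generated by variables. -/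
structure LinearStage (σ : Type u) (k : Type v) [Field k] where
  row : Type u
  col : Type u
  [fintypeRow : Fintype row]
  [fintypeCol : Fintype col]
  [linearOrder : LinearOrder col]
  e : ℕ
  vec : col → row → MvPolynomial σ k
  vars : col → Set σ
  homogeneous : ∀ i b, (vec i b).IsHomogeneous e
  colon : ∀ i r, r • vec i ∈ Submodule.span (MvPolynomial σ k) (vec '' Set.Iio i) ↔
    r ∈ Ideal.span (X '' vars i : Set (MvPolynomial σ k))

namespace LinearStage

attribute [instance] fintypeRow fintypeCol linearOrder

variable (A : LinearStage σ k)

lemma exists_linear_relation (i : A.col) (s : σ) (hs : s ∈ A.vars i) :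
    ∃ c : A.col → MvPolynomial σ k, (∀ j, (c j).IsHomogeneous 1) ∧ (∀ j, i ≤ j → c j = 0) ∧
      ∑ j, c j • A.vec j = (X s : MvPolynomial σ k) • A.vec i := by
  have h := (A.colon i (X s)).mpr (Ideal.subset_span ⟨s, hs, rfl⟩)
  obtain ⟨l, hl, hsum⟩ := (Finsupp.mem_span_image_iff_linearCombination _).1 h
  refine ⟨fun j => homogeneousComponent 1 (l j), fun j => homogeneousComponent_isHomogeneous _ _,
    fun j hj => ?_, ?_⟩
  · rw [Finsupp.mem_supported'] at hl
    simp [hl j (by simpa using hj)]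
  · rw [Finsupp.linearCombination_apply, Finsupp.sum_fintype _ _ (by simp)] at hsum
    funext b
    -- All vectors have degree `A.e`, so the part of the relation in degree `1 + A.e` uses only the
    -- linear parts of the coefficients.
    have hb := congrArg (homogeneousComponent (1 + A.e)) (congrFun hsum b)
    simp only [Finset.sum_apply, Pi.smul_apply, smul_eq_mul, map_sum] at hb ⊢
    rw [homogeneousComponent_mul_of_isHomogeneous 1 A.e _ (A.homogeneous i b)] at hb
    rw [homogeneousComponent_eq_self (isHomogeneous_X k s)] at hb
    rw [← hb]
    exact Finset.sum_congr rfl fun j _ =>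
      (homogeneousComponent_mul_of_isHomogeneous 1 A.e _ (A.homogeneous j b)).symm

/-- The coefficients of a relation expressing `X s • vec i` by smaller vectors. -/
noncomputable def tail (i : A.col) (s : A.vars i) : A.col → MvPolynomial σ k :=
  (A.exists_linear_relation i s s.2).choose

lemma tail_homogeneous (i : A.col) (s : A.vars i) (j : A.col) : (A.tail i s j).IsHomogeneous 1 :=
  (A.exists_linear_relation i s s.2).choose_spec.1 j

lemma tail_eq_zero (i : A.col) (s : A.vars i) {j : A.col} (h : i ≤ j) : A.tail i s j = 0 :=
  (A.exists_linear_relation i s s.2).choose_spec.2.1 j h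

lemma sum_tail (i : A.col) (s : A.vars i) :
    ∑ j, A.tail i s j • A.vec j = (X (s : σ) : MvPolynomial σ k) • A.vec i :=
  (A.exists_linear_relation i s s.2).choose_spec.2.2

/-- The linear syzygy with leading term `X s` at position `i`. -/
noncomputable def syz (p : Σₗ i : A.col, A.vars i) : A.col → MvPolynomial σ k :=
  Pi.single (ofLex p).1 (X ((ofLex p).2 : σ)) - A.tail (ofLex p).1 (ofLex p).2

lemma syz_homogeneous (p) (j : A.col) : (A.syz p j).IsHomogeneous 1 := by
  refine IsHomogeneous.sub ?_ (A.tail_homogeneous _ _ _)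
  rw [Pi.single_apply]
  split_ifs
  · exact isHomogeneous_X _ _
  · exact isHomogeneous_zero _ _ _

lemma syz_apply_self (p) : A.syz p (ofLex p).1 = X ((ofLex p).2 : σ) := by
  simp [syz, A.tail_eq_zero _ _ le_rfl]

lemma syz_apply_of_lt (p) {j : A.col} (h : (ofLex p).1 < j) : A.syz p j = 0 := by
  simp [syz, A.tail_eq_zero _ _ h.le, h.ne']

/-- The syzygy module of the vectors. -/
noncomputable def syzygies : Submodule (MvPolynomial σ k) (A.col → MvPolynomial σ k) :=
  LinearMap.ker (Fintype.linearCombination (MvPolynomial σ k) A.vec)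

lemma mem_syzygies {v : A.col → MvPolynomial σ k} :
    v ∈ A.syzygies ↔ ∑ i, v i • A.vec i = 0 := by
  rw [syzygies, LinearMap.mem_ker, Fintype.linearCombination_apply]

lemma syz_mem (p) : A.syz p ∈ A.syzygies := by
  simp only [mem_syzygies, syz, Pi.sub_apply, sub_smul, Finset.sum_sub_distrib, sum_tail]
  rw [Finset.sum_eq_single (ofLex p).1] <;> simp +contextual

/-- Division by leading position: the top coefficient of a syzygy lies in the colon ideal there, so
a combination of the linear syzygies at that position cancels it. Tracking the support `L` is what
`syz_colon` needs. -/
lemma mem_span_syz (L : Finset A.col) (hL : IsLowerSet (L : Set A.col))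
    (v : A.col → MvPolynomial σ k) (hv : v ∈ A.syzygies) (hs : ∀ j ∉ L, v j = 0) :
    v ∈ Submodule.span (MvPolynomial σ k) (A.syz '' {p | (ofLex p).1 ∈ L}) := by
  classical
  induction L using Finset.induction_on_max generalizing v with
  | empty =>
    have : v = 0 := funext fun j => hs j (by simp)
    simp [this]
  | insert a L ha ih =>
    have haL : a ∉ L := fun h => lt_irrefl _ (ha a h)
    have hL' : IsLowerSet (L : Set A.col) := by
      intro x y hyx hx
      have hy : y ∈ insert a L := hL hyx (by simpa using Or.inr hx)
      rcases Finset.mem_insert.mp hy with rfl | hy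
      · exact absurd (ha x hx) (not_lt.mpr hyx)
      · exact hy
    have hmono : Submodule.span (MvPolynomial σ k) (A.syz '' {p | (ofLex p).1 ∈ L}) ≤
        Submodule.span (MvPolynomial σ k) (A.syz '' {p | (ofLex p).1 ∈ insert a L}) :=
      Submodule.span_mono (Set.image_mono fun p hp => Finset.mem_insert_of_mem hp)
    have hlead : v a ∈ Ideal.span (X '' A.vars a : Set (MvPolynomial σ k)) := by
      rw [← A.colon]
      have h := A.mem_syzygies.mp hv
      rw [← Finset.add_sum_erase _ _ (Finset.mem_univ a)] at h
      rw [eq_neg_of_add_eq_zero_left h]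
      refine Submodule.neg_mem _ (Submodule.sum_mem _ fun j hj => ?_)
      by_cases hjL : j ∈ L
      · exact Submodule.smul_mem _ _ (Submodule.subset_span ⟨j, ha j hjL, rfl⟩)
      · rw [hs j (by simp_all), zero_smul]
        exact Submodule.zero_mem _
    have hw : ∃ w ∈ Submodule.span (MvPolynomial σ k) (A.syz '' {p | (ofLex p).1 = a}),
        w a = v a := by
      have hle : Ideal.span (X '' A.vars a : Set (MvPolynomial σ k)) ≤
          (Submodule.span (MvPolynomial σ k) (A.syz '' {p | (ofLex p).1 = a})).map
            (LinearMap.proj a) := by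
        rw [Ideal.span, Submodule.span_le]
        rintro _ ⟨s, hsa, rfl⟩
        exact ⟨A.syz (toLex ⟨a, s, hsa⟩), Submodule.subset_span ⟨_, rfl, rfl⟩,
          A.syz_apply_self (toLex ⟨a, s, hsa⟩)⟩
      exact hle hlead
    obtain ⟨w, hw, hwa⟩ := hw
    have hwle : Submodule.span (MvPolynomial σ k) (A.syz '' {p | (ofLex p).1 = a}) ≤
        A.syzygies := by
      rw [Submodule.span_le]
      rintro _ ⟨p, -, rfl⟩
      exact A.syz_mem p
    have hwz : ∀ j, a < j → w j = 0 := by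
      intro j hj
      have : Submodule.span (MvPolynomial σ k) (A.syz '' {p | (ofLex p).1 = a}) ≤
          LinearMap.ker (LinearMap.proj (R := MvPolynomial σ k)
            (φ := fun _ : A.col => MvPolynomial σ k) j) := by
        rw [Submodule.span_le]
        rintro _ ⟨p, rfl, rfl⟩
        exact A.syz_apply_of_lt p hj
      exact this hw
    have hrest := ih hL' (v - w) (Submodule.sub_mem _ hv (hwle hw)) (fun j hj => by
      by_cases hja : j = a
      · simp [hja, hwa]
      · have hjn : j ∉ insert a L := by simp [hja, hj]
        have : a < j := by
          by_contra hlt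
          exact hjn (hL (not_lt.mp hlt) (by simp))
        simp [hs j hjn, hwz j this])
    rw [← sub_add_cancel v w]
    refine Submodule.add_mem _ (hmono hrest) (Submodule.span_mono (Set.image_mono ?_) hw)
    rintro p rfl
    exact Finset.mem_insert_self _ _

lemma span_range_syz :
    Submodule.span (MvPolynomial σ k) (Set.range A.syz) = A.syzygies := by
  refine le_antisymm ?_ fun v hv => ?_
  · rw [Submodule.span_le]
    rintro _ ⟨p, rfl⟩
    exact A.syz_mem p
  · have := A.mem_span_syz Finset.univ (fun _ _ _ _ => by simp) v hv (by simp)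
    simpa using this

/-- At coordinate `i`, syzygies with smaller position vanish and those at `i` have a variable as
entry, which bounds the colon ideal from above. Koszul relations between two syzygies at `i` give
the converse. -/
lemma syz_colon [LinearOrder σ] (p : Σₗ i : A.col, A.vars i) (r : MvPolynomial σ k) :
    r • A.syz p ∈ Submodule.span (MvPolynomial σ k) (A.syz '' Set.Iio p) ↔
      r ∈ Ideal.span (X '' {t | t ∈ A.vars (ofLex p).1 ∧ t < (ofLex p).2} :
        Set (MvPolynomial σ k)) := by
  obtain ⟨i, s⟩ := p
  constructor
  · intro h
    have hle : Submodule.span (MvPolynomial σ k) (A.syz '' Set.Iio (toLex ⟨i, s⟩)) ≤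
        Submodule.comap
          (LinearMap.proj (R := MvPolynomial σ k) (φ := fun _ : A.col => MvPolynomial σ k) i)
          (Ideal.span (X '' {t | t ∈ A.vars i ∧ t < s} : Set (MvPolynomial σ k))) := by
      rw [Submodule.span_le]
      rintro _ ⟨⟨i', t⟩, hlt, rfl⟩
      rw [SetLike.mem_coe, Submodule.mem_comap, LinearMap.proj_apply]
      rcases Sigma.Lex.lt_def.mp hlt with h | ⟨h, h'⟩
      · rw [show A.syz ⟨i', t⟩ i = 0 from A.syz_apply_of_lt (toLex ⟨i', t⟩) h]
        exact Submodule.zero_mem _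
      · obtain rfl : i' = i := h
        rw [show A.syz ⟨i', t⟩ i' = X (t : σ) from A.syz_apply_self (toLex ⟨i', t⟩)]
        exact Ideal.subset_span ⟨t, ⟨t.2, h'⟩, rfl⟩
    have h1 := hle h
    refine mem_span_X_of_mul_X_mem (s := (s : σ)) (fun h => lt_irrefl _ h.2) ?_
    rw [← show A.syz ⟨i, s⟩ i = X (s : σ) from A.syz_apply_self (toLex ⟨i, s⟩)]
    exact h1
  · intro h
    have hle : Ideal.span (X '' {t | t ∈ A.vars i ∧ t < s} : Set (MvPolynomial σ k)) ≤
        (Submodule.span (MvPolynomial σ k) (A.syz '' Set.Iio (toLex ⟨i, s⟩))).comap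
          (LinearMap.toSpanSingleton (MvPolynomial σ k) _ (A.syz (toLex ⟨i, s⟩))) := by
      rw [Ideal.span, Submodule.span_le]
      rintro _ ⟨t, ⟨ht, hts⟩, rfl⟩
      rw [SetLike.mem_coe, Submodule.mem_comap, LinearMap.toSpanSingleton_apply]
      set q : Σₗ i : A.col, A.vars i := toLex ⟨i, ⟨t, ht⟩⟩ with hq
      have hlt : q < toLex ⟨i, s⟩ := Sigma.Lex.lt_def.mpr (Or.inr ⟨rfl, hts⟩)
      -- The difference is a syzygy whose coordinate `i` cancels, so `mem_span_syz` writes it with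
      -- positions strictly below `i`.
      rw [← sub_add_cancel ((X t : MvPolynomial σ k) • A.syz (toLex ⟨i, s⟩))
        ((X (s : σ) : MvPolynomial σ k) • A.syz q)]
      refine Submodule.add_mem _ ?_ (Submodule.smul_mem _ _ (Submodule.subset_span ⟨q, hlt, rfl⟩))
      have hmem := A.mem_span_syz (Finset.univ.filter (· < i))
        (fun x y hyx hx => by simp at hx ⊢; exact hyx.trans_lt hx)
        ((X t : MvPolynomial σ k) • A.syz (toLex ⟨i, s⟩) -
          (X (s : σ) : MvPolynomial σ k) • A.syz q)
        (Submodule.sub_mem _ (Submodule.smul_mem _ _ (A.syz_mem _))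
          (Submodule.smul_mem _ _ (A.syz_mem _))) (fun j hj => by
          have hij : i ≤ j := by simpa using hj
          rcases hij.eq_or_lt with rfl | hij
          · have h1 : A.syz (toLex ⟨i, s⟩) i = X (s : σ) := A.syz_apply_self (toLex ⟨i, s⟩)
            have h2 : A.syz q i = X t := A.syz_apply_self q
            simp only [Pi.sub_apply, Pi.smul_apply, smul_eq_mul, h1, h2]
            ring
          · simp [A.syz_apply_of_lt (toLex ⟨i, s⟩) hij, A.syz_apply_of_lt q hij])
      refine Submodule.span_mono (Set.image_mono ?_) hmem
      rintro ⟨i', t'⟩ hp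
      exact Sigma.Lex.lt_def.mpr (Or.inl (Finset.mem_filter.mp hp).2)
    exact hle h

/-- The linear stage formed by the linear syzygies. -/
noncomputable def next [LinearOrder σ] [Finite σ] : LinearStage σ k where
  row := A.col
  col := Σₗ i : A.col, A.vars i
  fintypeCol := by
    classical
    haveI : ∀ i, Fintype (A.vars i) := fun i => Fintype.ofFinite _
    exact inferInstanceAs (Fintype (Σ i : A.col, A.vars i))
  e := 1
  vec := A.syz
  vars := fun p => {t | t ∈ A.vars (ofLex p).1 ∧ t < (ofLex p).2}
  homogeneous := A.syz_homogeneous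
  colon := A.syz_colon

/-- The sequence of iterated syzygies. -/
noncomputable def iter [LinearOrder σ] [Finite σ] : ℕ → LinearStage σ k
  | 0 => A
  | n + 1 => (iter n).next

/-- The matrix whose columns are the vectors of the stage. -/
noncomputable def mat : Matrix A.row A.col (MvPolynomial σ k) := Matrix.of fun b i => A.vec i b

lemma mat_mulVecLin : A.mat.mulVecLin = Fintype.linearCombination (MvPolynomial σ k) A.vec := by
  refine LinearMap.ext fun v => funext fun b => ?_
  simp [mat, Matrix.mulVec, dotProduct, Fintype.linearCombination_apply, mul_comm]

lemma range_mulVecLin_mat :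
    LinearMap.range A.mat.mulVecLin = Submodule.span (MvPolynomial σ k) (Set.range A.vec) := by
  rw [mat_mulVecLin, Fintype.range_linearCombination]

lemma exact_next [LinearOrder σ] [Finite σ] :
    Function.Exact A.next.mat.mulVecLin A.mat.mulVecLin := by
  have h : LinearMap.ker A.mat.mulVecLin = LinearMap.range A.next.mat.mulVecLin := by
    rw [range_mulVecLin_mat, mat_mulVecLin]
    exact A.span_range_syz.symm
  exact LinearMap.exact_iff.mpr h

end LinearStage

lemma mem_idealOfVars_of_isHomogeneous {p : MvPolynomial σ k} {n : ℕ} (h : p.IsHomogeneous n)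
    (hn : 0 < n) : p ∈ idealOfVars σ k := by
  rw [← pow_one (idealOfVars σ k), mem_pow_idealOfVars_iff]
  intro x hx
  have := h (mem_support_iff.mp hx)
  rw [Finsupp.degree_eq_weight_one]
  change 1 ≤ Finsupp.weight 1 x
  omega

/-- An ideal whose generators form a linear stage of positive degree has a linear resolution. -/
theorem hasLinearResolution_of_linearStage [Finite σ] (I : Ideal (MvPolynomial σ k))
    (A : LinearStage σ k) [Unique A.row] (hA : 0 < A.e)
    (hI : I = Ideal.span (Set.range fun i => A.vec i default)) : HasLinearResolution I := by
  classical
  have : Fintype σ := Fintype.ofFinite σ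
  let : LinearOrder σ := LinearOrder.lift' (Fintype.equivFin σ) (Fintype.equivFin σ).injective
  have hpos : ∀ n, 0 < (A.iter n).e := fun n => by
    cases n with
    | zero => exact hA
    | succ n => exact Nat.one_pos
  refine ⟨{
    ι := fun n => (A.iter n).row
    fintype := fun n => (A.iter n).fintypeRow
    -- Each matrix is homogeneous of a single degree, so the shifts are the accumulated degrees.
    deg := fun n _ => ∑ i ∈ Finset.range n, (A.iter i).e
    d := fun n => (A.iter n).mat
    gen := fun _ => 1
    gen_homogeneous := fun _ => ⟨1, by simpa using isHomogeneous_one σ k, map_one _⟩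
    d_homogeneous := fun n a b _ => ⟨(A.iter n).e, (Finset.sum_range_succ _ _).symm,
      (A.iter n).homogeneous b a⟩
    surjective := ?_
    exact_zero := ?_
    exact_succ := fun n => (A.iter n).exact_next
    minimal := fun n a b => mem_idealOfVars_of_isHomogeneous ((A.iter n).homogeneous b a) (hpos n)
    }, ?_⟩
  · intro x
    obtain ⟨p, rfl⟩ := Ideal.Quotient.mk_surjective x
    refine ⟨fun _ => p, ?_⟩
    change Fintype.linearCombination (MvPolynomial σ k)
      (fun _ : A.row => (1 : MvPolynomial σ k ⧸ I)) (fun _ => p) = _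
    simp [Fintype.linearCombination_apply, ← Algebra.algebraMap_eq_smul_one]
  · change Function.Exact A.mat.mulVecLin (Fintype.linearCombination (MvPolynomial σ k)
      (fun _ : A.row => (1 : MvPolynomial σ k ⧸ I)))
    rw [LinearMap.exact_iff, LinearStage.range_mulVecLin_mat]
    ext v
    have h1 : v ∈ LinearMap.ker (Fintype.linearCombination (MvPolynomial σ k)
        (fun _ : A.row => (1 : MvPolynomial σ k ⧸ I))) ↔ v default ∈ I := by
      simp [Fintype.linearCombination_apply, ← Algebra.algebraMap_eq_smul_one,
        Ideal.Quotient.eq_zero_iff_mem]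
    let φ := LinearEquiv.funUnique A.row (MvPolynomial σ k) (MvPolynomial σ k)
    have h2 : I = (Submodule.span (MvPolynomial σ k) (Set.range A.vec)).map φ.toLinearMap := by
      rw [Submodule.map_span, ← Set.range_comp, hI]
      rfl
    rw [h1, h2]
    constructor
    · rintro ⟨w, hw, hwv⟩
      rwa [← φ.injective hwv]
    · intro h
      exact ⟨v, h, rfl⟩
  · intro n hn a b _
    -- Every stage after the initial one is a `next`, whose degree is 1 by definition.
    obtain ⟨m, rfl⟩ : ∃ m, n = m + 1 := ⟨n - 1, by omega⟩
    exact (A.iter (m + 1)).homogeneous b a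

end LinearStages

/-! ### Linear quotients as an exchange property -/

section LinearQuotients

variable {σ : Type u}

/-- A family of finite sets that can be built up by adding one set `A` at a time, such that from
every earlier set `B` some element can be moved into `A`, in exchange for an element of `A`, with
an earlier set as the result. -/
inductive HasLinearQuotients [DecidableEq σ] : Set (Finset σ) → Prop
  | empty : HasLinearQuotients ∅
  | adjoin {𝒜 : Set (Finset σ)} {A : Finset σ} : HasLinearQuotients 𝒜 → A ∉ 𝒜 →
      (∀ B ∈ 𝒜, ∃ s ∈ B, s ∉ A ∧ ∃ t ∈ A, insert s (A.erase t) ∈ 𝒜) →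
      HasLinearQuotients (insert A 𝒜)

namespace HasLinearQuotients

variable [DecidableEq σ]

lemma singleton (A : Finset σ) : HasLinearQuotients {A} := by
  simpa using HasLinearQuotients.adjoin (A := A) .empty (by simp) (by simp)

/-- The members of `ℬ` are adjoined after all of `𝒜`, in their own order. -/
lemma union {𝒜 ℬ : Set (Finset σ)} (h𝒜 : HasLinearQuotients 𝒜) (hℬ : HasLinearQuotients ℬ)
    (hdisj : ∀ A ∈ ℬ, A ∉ 𝒜)
    (hex : ∀ A ∈ ℬ, ∀ B ∈ 𝒜, ∃ s ∈ B, s ∉ A ∧ ∃ t ∈ A, insert s (A.erase t) ∈ 𝒜) :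
    HasLinearQuotients (𝒜 ∪ ℬ) := by
  induction hℬ with
  | empty => simpa using h𝒜
  | @adjoin ℬ A _ hA h ih =>
    rw [Set.union_insert]
    refine .adjoin (ih (fun C hC => hdisj C (Set.mem_insert_of_mem _ hC))
      (fun C hC => hex C (Set.mem_insert_of_mem _ hC))) ?_ ?_
    · rintro (h' | h')
      exacts [hdisj A (Set.mem_insert _ _) h', hA h']
    · rintro B (hB | hB)
      · obtain ⟨s, hs, hsA, t, ht, hm⟩ := hex A (Set.mem_insert _ _) B hB
        exact ⟨s, hs, hsA, t, ht, Or.inl hm⟩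
      · obtain ⟨s, hs, hsA, t, ht, hm⟩ := h B hB
        exact ⟨s, hs, hsA, t, ht, Or.inr hm⟩

lemma image_insert {𝒜 : Set (Finset σ)} (h𝒜 : HasLinearQuotients 𝒜) {v : σ}
    (hv : ∀ A ∈ 𝒜, v ∉ A) : HasLinearQuotients (insert v '' 𝒜) := by
  induction h𝒜 with
  | empty => simpa using HasLinearQuotients.empty
  | @adjoin 𝒜 A _ hA h ih =>
    have hvA := hv A (Set.mem_insert _ _)
    have hv' : ∀ B ∈ 𝒜, v ∉ B := fun B hB => hv B (Set.mem_insert_of_mem _ hB)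
    rw [Set.image_insert_eq]
    refine .adjoin (ih hv') ?_ ?_
    · rintro ⟨B, hB, hBA⟩
      apply hA
      rwa [← Finset.erase_insert hvA, ← hBA, Finset.erase_insert (hv' B hB)]
    · rintro _ ⟨B, hB, rfl⟩
      obtain ⟨s, hs, hsA, t, ht, hm⟩ := h B hB
      have hsv : s ≠ v := fun h => hv' B hB (h ▸ hs)
      have htv : t ≠ v := fun h => hvA (h ▸ ht)
      refine ⟨s, Finset.mem_insert_of_mem hs, by simp [hsv, hsA], t,
        Finset.mem_insert_of_mem ht, _, hm, ?_⟩
      rw [Finset.erase_insert_of_ne htv.symm, Finset.insert_comm]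

/-- Turns the order of construction into a numerical one. The strict bound `n` serves as the rank of
the next set adjoined. -/
lemma exists_rank {𝒜 : Set (Finset σ)} (h𝒜 : HasLinearQuotients 𝒜) :
    ∃ (ρ : Finset σ → ℕ) (n : ℕ), Set.InjOn ρ 𝒜 ∧ (∀ A ∈ 𝒜, ρ A < n) ∧
      ∀ A ∈ 𝒜, ∀ B ∈ 𝒜, ρ B < ρ A →
        ∃ s ∈ B, s ∉ A ∧ ∃ t ∈ A, insert s (A.erase t) ∈ 𝒜 ∧ ρ (insert s (A.erase t)) < ρ A := by
  induction h𝒜 with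
  | empty => exact ⟨fun _ => 0, 0, by simp, by simp, by simp⟩
  | @adjoin 𝒜 A _ hA h ih =>
    obtain ⟨ρ, n, hinj, hlt, hex⟩ := ih
    have hself : Function.update ρ A n A = n := Function.update_self ..
    have hne : ∀ B ∈ 𝒜, Function.update ρ A n B = ρ B := fun B hB =>
      Function.update_of_ne (fun h : B = A => hA (h ▸ hB)) _ _
    refine ⟨Function.update ρ A n, n + 1, ?_, ?_, ?_⟩
    · rintro B (rfl | hB) C (rfl | hC) hBC
      · rfl
      · rw [hself, hne C hC] at hBC
        exact absurd (hlt C hC) (by omega)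
      · rw [hself, hne B hB] at hBC
        exact absurd (hlt B hB) (by omega)
      · rw [hne B hB, hne C hC] at hBC
        exact hinj hB hC hBC
    · rintro B (rfl | hB)
      · rw [hself]; omega
      · rw [hne B hB]; exact (hlt B hB).trans (Nat.lt_succ_self n)
    · rintro B (rfl | hB) C (rfl | hC) hCB
      · exact absurd hCB (lt_irrefl _)
      · obtain ⟨s, hs, hsA, t, ht, hm⟩ := h C hC
        refine ⟨s, hs, hsA, t, ht, Or.inr hm, ?_⟩
        rw [hself, hne _ hm]
        exact hlt _ hm
      · rw [hself, hne B hB] at hCB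
        exact absurd (hlt B hB) (by omega)
      · rw [hne B hB, hne C hC] at hCB
        obtain ⟨s, hs, hsA, t, ht, hm, hr⟩ := hex B hB C hC hCB
        refine ⟨s, hs, hsA, t, ht, Or.inr hm, ?_⟩
        rwa [hne B hB, hne _ hm]

end HasLinearQuotients

/-! ### Vertex covers of forests -/

/-- A family of finite sets is a forest if each nonempty subfamily has a leaf. -/
def IsForestFamily (H : Finset (Finset σ)) : Prop :=
  ∀ S ⊆ H, S.Nonempty → ∃ F ∈ S, S = {F} ∨
    ∃ G ∈ S, G ≠ F ∧ ∀ E ∈ S, E ≠ F → ∀ x ∈ F, x ∈ E → x ∈ G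

lemma IsForestFamily.mono {H H' : Finset (Finset σ)} (h : IsForestFamily H) (hs : H' ⊆ H) :
    IsForestFamily H' := fun S hS => h S (hS.trans hs)

lemma IsForestFamily.image_sdiff [DecidableEq σ] {H : Finset (Finset σ)} (h : IsForestFamily H)
    (W : Finset σ) : IsForestFamily (H.image (· \ W)) := by
  intro S hS hne
  -- One preimage is chosen for each trace, so that a leaf and its witness `G` stay distinct after
  -- removing `W`.
  obtain ⟨S', hS', hinj, rfl⟩ : ∃ S' ⊆ H, Set.InjOn (· \ W) (S' : Set (Finset σ)) ∧
      S'.image (· \ W) = S := by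
    obtain ⟨S', hS', hb⟩ := Set.SurjOn.exists_bijOn_subset (f := (· \ W))
      (s := (H : Set (Finset σ))) (t := (S : Set (Finset σ))) (fun E hE => by
        simpa using hS hE)
    have hfin : S'.Finite := H.finite_toSet.subset hS'
    refine ⟨hfin.toFinset, by simpa [Set.subset_def, Finset.subset_iff] using hS', by simpa using hb.injOn, ?_⟩
    ext E
    have := Set.ext_iff.mp hb.image_eq E
    simpa using this
  obtain ⟨F, hF, hleaf⟩ := h S' hS' (by simpa using hne)
  refine ⟨F \ W, Finset.mem_image_of_mem _ hF, ?_⟩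
  rcases hleaf with h1 | ⟨G, hG, hGF, hGx⟩
  · left
    rw [h1, Finset.image_singleton]
  · right
    refine ⟨G \ W, Finset.mem_image_of_mem _ hG, fun h => hGF (hinj hG hF h), ?_⟩
    intro E hE hEF x hxF hxE
    obtain ⟨E, hE', rfl⟩ := Finset.mem_image.mp hE
    rw [Finset.mem_sdiff] at *
    exact ⟨hGx E hE' (fun h => hEF (h ▸ rfl)) x hxF.1 hxE.1, hxF.2⟩

/-- The subsets of `V` with `j` elements that meet each member of `H`. -/
def covers (V : Finset σ) (H : Finset (Finset σ)) (j : ℕ) : Set (Finset σ) :=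
  {A | A ⊆ V ∧ A.card = j ∧ ∀ E ∈ H, ∃ x ∈ A, x ∈ E}

lemma covers_zero (V : Finset σ) (H : Finset (Finset σ)) :
    covers V H 0 = ∅ ∨ covers V H 0 = {∅} := by
  refine Set.subset_singleton_iff_eq.mp ?_
  rintro A ⟨-, hA, -⟩
  exact Finset.card_eq_zero.mp hA

lemma hasLinearQuotients_covers_zero [DecidableEq σ] (V : Finset σ) (H : Finset (Finset σ)) :
    HasLinearQuotients (covers V H 0) := by
  rcases covers_zero V H with h | h <;> rw [h]
  exacts [.empty, .singleton _]

lemma hasLinearQuotients_covers_empty [DecidableEq σ] (V : Finset σ) (j : ℕ) :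
    HasLinearQuotients (covers V ∅ j) := by
  induction V using Finset.induction_on generalizing j with
  | empty =>
    cases j with
    | zero => exact hasLinearQuotients_covers_zero _ _
    | succ j =>
      suffices h : covers (∅ : Finset σ) ∅ (j + 1) = ∅ from h ▸ .empty
      refine Set.eq_empty_of_forall_notMem ?_
      rintro A ⟨hA, hc, -⟩
      rw [Finset.subset_empty.mp hA] at hc
      simp at hc
  | insert v V hv ih =>
    cases j with
    | zero => exact hasLinearQuotients_covers_zero _ _
    | succ j =>
      -- Sets containing `v` come first: `v` can replace any element of a set avoiding it.
      have heq : covers (insert v V) ∅ (j + 1) =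
          insert v '' covers V ∅ j ∪ covers V ∅ (j + 1) := by
        ext A
        constructor
        · rintro ⟨hA, hc, -⟩
          by_cases hvA : v ∈ A
          · refine Or.inl ⟨A.erase v, ⟨?_, ?_, by simp⟩, Finset.insert_erase hvA⟩
            · intro x hx
              exact (Finset.mem_insert.mp (hA (Finset.mem_of_mem_erase hx))).resolve_left
                (Finset.ne_of_mem_erase hx)
            · rw [Finset.card_erase_of_mem hvA, hc]; rfl
          · exact Or.inr ⟨(Finset.subset_insert_iff_of_notMem hvA).mp hA, hc, by simp⟩
        · rintro (⟨A, ⟨hA, hc, -⟩, rfl⟩ | ⟨hA, hc, -⟩)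
          · refine ⟨Finset.insert_subset_insert _ hA, ?_, by simp⟩
            rw [Finset.card_insert_of_notMem (fun h => hv (hA h)), hc]
          · exact ⟨hA.trans (Finset.subset_insert _ _), hc, by simp⟩
      rw [heq]
      refine ((ih j).image_insert fun A hA h => hv (hA.1 h)).union (ih (j + 1)) ?_ ?_
      · rintro A hA ⟨B, -, rfl⟩
        exact hv (hA.1 (Finset.mem_insert_self _ _))
      · rintro A ⟨hA, hc, -⟩ _ ⟨B, -, rfl⟩
        obtain ⟨t, ht⟩ : A.Nonempty := Finset.card_pos.mp (by omega)
        refine ⟨v, Finset.mem_insert_self _ _, fun h => hv (hA h), t, ht, A.erase t,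
          ⟨(Finset.erase_subset _ _).trans hA, ?_, by simp⟩, rfl⟩
        rw [Finset.card_erase_of_mem ht, hc]; rfl

/-- Covers, split by whether they meet `F` outside a vertex `v` that lies in no other set. -/
lemma covers_succ_eq_union [DecidableEq σ] {V : Finset σ} {H : Finset (Finset σ)} {F : Finset σ}
    {v : σ} (hF : F ∈ H) (hvF : v ∈ F) (hfree : ∀ E ∈ H, v ∈ E → E = F) (hvV : v ∈ V) (j : ℕ) :
    covers V H (j + 1) = covers V (H.image (· \ {v})) (j + 1) ∪
      insert v '' covers (V \ F) ((H.erase F).image (· \ F)) j := by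
  ext A
  constructor
  · rintro ⟨hAV, hc, hA⟩
    by_cases hAF : ∃ x ∈ A, x ∈ F \ {v}
    · refine Or.inl ⟨hAV, hc, fun E hE => ?_⟩
      obtain ⟨E, hE', rfl⟩ := Finset.mem_image.mp hE
      by_cases hEF : E = F
      · rwa [hEF]
      · obtain ⟨x, hxA, hxE⟩ := hA E hE'
        refine ⟨x, hxA, Finset.mem_sdiff.mpr ⟨hxE, fun hx => hEF (hfree E hE' ?_)⟩⟩
        rwa [← Finset.mem_singleton.mp hx]
    · push Not at hAF
      have hAF' : ∀ x ∈ A, x ∈ F → x = v := fun x hx hxF => by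
        by_contra hne
        exact hAF x hx (by simp [hxF, hne])
      obtain ⟨x, hxA, hxF⟩ := hA F hF
      obtain rfl := hAF' x hxA hxF
      refine Or.inr ⟨A.erase x, ⟨fun y hy => ?_, ?_, fun E hE => ?_⟩, Finset.insert_erase hxA⟩
      · rw [Finset.mem_erase] at hy
        exact Finset.mem_sdiff.mpr ⟨hAV hy.2, fun h => hy.1 (hAF' y hy.2 h)⟩
      · rw [Finset.card_erase_of_mem hxA, hc]; rfl
      · obtain ⟨E, hE', rfl⟩ := Finset.mem_image.mp hE
        obtain ⟨hEF, hE⟩ := Finset.mem_erase.mp hE'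
        obtain ⟨y, hyA, hyE⟩ := hA E hE
        have hyx : y ≠ x := fun h => hEF (hfree E hE (h ▸ hyE))
        exact ⟨y, Finset.mem_erase.mpr ⟨hyx, hyA⟩,
          Finset.mem_sdiff.mpr ⟨hyE, fun h => hyx (hAF' y hyA h)⟩⟩
  · rintro (⟨hAV, hc, hA⟩ | ⟨A, ⟨hAV, hc, hA⟩, rfl⟩)
    · refine ⟨hAV, hc, fun E hE => ?_⟩
      obtain ⟨x, hxA, hx⟩ := hA _ (Finset.mem_image_of_mem _ hE)
      exact ⟨x, hxA, (Finset.mem_sdiff.mp hx).1⟩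
    · refine ⟨Finset.insert_subset hvV (hAV.trans Finset.sdiff_subset), ?_, fun E hE => ?_⟩
      · rw [Finset.card_insert_of_notMem (fun h => (Finset.mem_sdiff.mp (hAV h)).2 hvF), hc]
      · by_cases hEF : E = F
        · exact ⟨v, Finset.mem_insert_self _ _, hEF ▸ hvF⟩
        · obtain ⟨x, hxA, hx⟩ := hA _ (Finset.mem_image_of_mem _ (Finset.mem_erase.mpr ⟨hEF, hE⟩))
          exact ⟨x, Finset.mem_insert_of_mem hxA, (Finset.mem_sdiff.mp hx).1⟩

lemma covers_eq_of_notMem [DecidableEq σ] {V : Finset σ} {v : σ} (hv : v ∉ V)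
    (H : Finset (Finset σ)) (j : ℕ) : covers V H j = covers V (H.image (· \ {v})) j := by
  ext A
  refine and_congr_right fun hAV => and_congr_right fun _ => ?_
  simp only [Finset.forall_mem_image, Finset.mem_sdiff, Finset.mem_singleton]
  refine forall₂_congr fun E _ => exists_congr fun x => and_congr_right fun hx => ?_
  exact (and_iff_left fun h : x = v => hv (h ▸ hAV hx)).symm

lemma sum_card_image_sdiff_le [DecidableEq σ] (H : Finset (Finset σ)) (W : Finset σ) :
    ∑ E ∈ H.image (· \ W), (E.card + 1) ≤ ∑ E ∈ H, ((E \ W).card + 1) :=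
  Finset.sum_image_le_of_nonneg (fun _ _ => Nat.zero_le _)

theorem IsForestFamily.hasLinearQuotients_covers [DecidableEq σ] {H : Finset (Finset σ)}
    (hH : IsForestFamily H) (V : Finset σ) (j : ℕ) : HasLinearQuotients (covers V H j) := by
  -- The summand 1 makes the measure drop when any member is removed, even an empty one.
  induction hn : ∑ E ∈ H, (E.card + 1) using Nat.strong_induction_on generalizing H V j with
  | _ n ih =>
  subst hn
  rcases H.eq_empty_or_nonempty with rfl | hne
  · exact hasLinearQuotients_covers_empty V j
  cases j with
  | zero => exact hasLinearQuotients_covers_zero V H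
  | succ j =>
  by_cases hempty : ∅ ∈ H
  · suffices h : covers V H (j + 1) = ∅ from h ▸ .empty
    refine Set.eq_empty_of_forall_notMem fun A hA => ?_
    obtain ⟨x, -, hx⟩ := hA.2.2 ∅ hempty
    simp at hx
  have herase : ∀ G ∈ H, ∑ E ∈ H.erase G, (E.card + 1) < ∑ E ∈ H, (E.card + 1) := fun G hG => by
    rw [← Finset.add_sum_erase H _ hG]; omega
  -- Traces of an antichain need not form one. A member containing another imposes no condition on
  -- covers and is discarded.
  by_cases hanti : ∃ F ∈ H, ∃ G ∈ H, G ≠ F ∧ F ⊆ G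
  · obtain ⟨F, hF, G, hG, hGF, hFG⟩ := hanti
    have heq : covers V H (j + 1) = covers V (H.erase G) (j + 1) := by
      ext A
      refine and_congr_right fun _ => and_congr_right fun _ => ?_
      refine ⟨fun h E hE => h E (Finset.mem_of_mem_erase hE), fun h E hE => ?_⟩
      by_cases hEG : E = G
      · obtain ⟨x, hxA, hx⟩ := h F (Finset.mem_erase.mpr ⟨hGF.symm, hF⟩)
        exact ⟨x, hxA, hEG ▸ hFG hx⟩
      · exact h E (Finset.mem_erase.mpr ⟨hEG, hE⟩)
    rw [heq]
    exact ih _ (herase G hG) (hH.mono (Finset.erase_subset _ _)) V (j + 1) rfl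
  push Not at hanti
  obtain ⟨F, hF, v, hvF, hfree⟩ : ∃ F ∈ H, ∃ v ∈ F, ∀ E ∈ H, v ∈ E → E = F := by
    obtain ⟨F, hF, h | ⟨G, hG, hGF, h⟩⟩ := hH H subset_rfl hne
    · obtain ⟨v, hv⟩ : F.Nonempty := Finset.nonempty_iff_ne_empty.mpr fun h0 => hempty (h0 ▸ hF)
      exact ⟨F, hF, v, hv, fun E hE _ => by rw [h] at hE; exact Finset.mem_singleton.mp hE⟩
    -- By incomparability the leaf is not contained in `G`; a vertex outside `G` lies in no other
    -- member.
    · obtain ⟨v, hvF, hvG⟩ := Finset.not_subset.mp (hanti F hF G hG hGF)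
      exact ⟨F, hF, v, hvF, fun E hE hvE => by_contra fun hEF => hvG (h E hE hEF v hvF hvE)⟩
  have h1 : HasLinearQuotients (covers V (H.image (· \ {v})) (j + 1)) := by
    refine ih _ ((sum_card_image_sdiff_le H {v}).trans_lt ?_) (hH.image_sdiff {v}) V (j + 1) rfl
    refine Finset.sum_lt_sum (fun E _ => ?_) ⟨F, hF, ?_⟩
    · have := Finset.card_le_card (Finset.sdiff_subset (s := E) (t := {v})); omega
    · have : (F \ {v}).card < F.card := Finset.card_lt_card
        (Finset.ssubset_iff_of_subset Finset.sdiff_subset |>.mpr ⟨v, hvF, by simp⟩)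
      omega
  by_cases hvV : v ∈ V
  swap
  · rw [covers_eq_of_notMem hvV]
    exact h1
  have h2 : HasLinearQuotients (covers (V \ F) ((H.erase F).image (· \ F)) j) := by
    refine ih _ ((sum_card_image_sdiff_le _ F).trans_lt (lt_of_le_of_lt ?_ (herase F hF)))
      ((hH.mono (Finset.erase_subset _ _)).image_sdiff F) (V \ F) j rfl
    refine Finset.sum_le_sum fun E _ => ?_
    have := Finset.card_le_card (Finset.sdiff_subset (s := E) (t := F)); omega
  have hnot : ∀ A ∈ covers (V \ F) ((H.erase F).image (· \ F)) j, ∀ x ∈ A, x ∉ F :=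
    fun A hA x hx => (Finset.mem_sdiff.mp (hA.1 hx)).2
  rw [covers_succ_eq_union hF hvF hfree hvV]
  refine h1.union (h2.image_insert fun A hA h => hnot A hA v h hvF) ?_ ?_
  · rintro _ ⟨A, hA, rfl⟩ hmem
    obtain ⟨x, hx, hxF⟩ := hmem.2.2 _ (Finset.mem_image_of_mem _ hF)
    rw [Finset.mem_sdiff, Finset.mem_singleton] at hxF
    rcases Finset.mem_insert.mp hx with h | h
    · exact hxF.2 h
    · exact hnot A hA x h hxF.1
  · rintro _ ⟨A, hA, rfl⟩ B hB
    obtain ⟨s, hsB, hsF⟩ := hB.2.2 _ (Finset.mem_image_of_mem _ hF)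
    rw [Finset.mem_sdiff, Finset.mem_singleton] at hsF
    have hvA : v ∉ A := fun h => hnot A hA v h hvF
    have hsA : s ∉ A := fun h => hnot A hA s h hsF.1
    -- Exchanging `v` for `s` keeps `F` covered away from `v`; the other members are already covered
    -- by `A`.
    refine ⟨s, hsB, by simp [hsF.2, hsA], v, Finset.mem_insert_self _ _, ?_⟩
    rw [Finset.erase_insert hvA]
    refine ⟨Finset.insert_subset (hB.1 hsB) (hA.1.trans Finset.sdiff_subset), ?_, fun E hE => ?_⟩
    · rw [Finset.card_insert_of_notMem hsA, hA.2.1]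
    · obtain ⟨E, hE', rfl⟩ := Finset.mem_image.mp hE
      by_cases hEF : E = F
      · exact ⟨s, Finset.mem_insert_self _ _, by simp [hEF, hsF.1, hsF.2]⟩
      · obtain ⟨x, hxA, hx⟩ :=
          hA.2.2 _ (Finset.mem_image_of_mem _ (Finset.mem_erase.mpr ⟨hEF, hE'⟩))
        refine ⟨x, Finset.mem_insert_of_mem hxA, ?_⟩
        rw [Finset.mem_sdiff, Finset.mem_singleton]
        exact ⟨(Finset.mem_sdiff.mp hx).1, fun h => hvA (h ▸ hxA)⟩

end LinearQuotients

/-! ### Facets and minimal vertex covers -/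

namespace SimplicialComplex

variable {σ : Type u}

lemma facets_generatedBy {S : Set (Finset σ)} (hS : IsAntichain (· ⊆ ·) S) :
    (generatedBy S).facets = S := by
  ext F
  constructor
  · rintro ⟨⟨G, hG, hFG⟩, hmax⟩
    rwa [hFG.antisymm (hmax ⟨G, hG, subset_rfl⟩ hFG)]
  · intro hF
    refine ⟨⟨F, hF, subset_rfl⟩, ?_⟩
    rintro E ⟨G, hG, hEG⟩ hFE
    rwa [hS.eq hF hG (hFE.trans hEG)]

lemma isAntichain_facets (Δ : SimplicialComplex σ) : IsAntichain (· ⊆ ·) Δ.facets :=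
  setOfPred_maximal_antichain _

lemma IsForest.isForestFamily {Δ : SimplicialComplex σ} (hΔ : Δ.IsForest)
    (hfin : Δ.facets.Finite) : IsForestFamily hfin.toFinset := by
  intro S hS hne
  have hS' : (S : Set (Finset σ)) ⊆ Δ.facets := fun F hF => hfin.mem_toFinset.mp (hS hF)
  have hΓ := facets_generatedBy (Δ.isAntichain_facets.subset hS')
  obtain ⟨F, hF, hleaf⟩ := hΔ (generatedBy S) (by rwa [IsSubcollection, hΓ])
    (by rw [hΓ]; exact hne)
  rw [hΓ] at hF hleaf
  refine ⟨F, hF, hleaf.imp (fun h => by exact_mod_cast h) ?_⟩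
  rintro ⟨G, hG, hGF, h⟩
  exact ⟨G, hG, hGF, fun E hE hEF x hxF hxE => h E hE hEF ⟨hxF, hxE⟩⟩

lemma vertices_generatedBy (S : Set (Finset σ)) (x : σ) :
    x ∈ (generatedBy S).vertices ↔ ∃ F ∈ S, x ∈ F := by
  simp [vertices, generatedBy]

lemma exists_facet_coverComplex_subset_iff {S : Set (Finset σ)} (hS : IsAntichain (· ⊆ ·) S)
    (A : Finset σ) : (∃ C ∈ (generatedBy S).coverComplex.facets, C ⊆ A) ↔
      ∀ F ∈ S, ∃ x ∈ A, x ∈ F := by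
  classical
  rw [coverComplex, facets_generatedBy (setOfPred_minimal_antichain _)]
  constructor
  · rintro ⟨C, hC, hCA⟩ F hF
    obtain ⟨x, hxC, hxF⟩ := hC.1.2 F (by rwa [facets_generatedBy hS])
    exact ⟨x, hCA hxC, hxF⟩
  · intro h
    obtain ⟨C, hCA, hC⟩ := exists_minimal_le_of_wellFoundedLT (generatedBy S).IsVertexCover
      -- A vertex cover may only contain vertices of the complex, while `A` is arbitrary.
      (A.filter fun x => x ∈ (generatedBy S).vertices) (by
        refine ⟨fun x hx => (Finset.mem_filter.mp hx).2, fun F hF => ?_⟩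
        rw [facets_generatedBy hS] at hF
        obtain ⟨x, hxA, hxF⟩ := h F hF
        exact ⟨x, Finset.mem_filter.mpr
          ⟨hxA, (vertices_generatedBy S x).mpr ⟨F, hF, hxF⟩⟩, hxF⟩)
    exact ⟨C, hC, hCA.trans (Finset.filter_subset _ _)⟩

end SimplicialComplex

/-! ### Square-free monomial ideals -/

section SquarefreeIdeals

variable {σ : Type u} {k : Type v} [Field k]

lemma squarefreeMonomial_eq_monomial (F : Finset σ) :
    squarefreeMonomial k F = monomial (∑ i ∈ F, Finsupp.single i 1) 1 := by
  rw [monomial_sum_one]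
  rfl

lemma isHomogeneous_squarefreeMonomial (F : Finset σ) :
    (squarefreeMonomial k F).IsHomogeneous F.card := by
  have := IsHomogeneous.prod F (fun i => (X i : MvPolynomial σ k)) (fun _ => 1)
    fun i _ => isHomogeneous_X k i
  simpa using! this

lemma sum_single_apply_ne_zero (F : Finset σ) (i : σ) :
    (∑ j ∈ F, Finsupp.single j 1 : σ →₀ ℕ) i ≠ 0 ↔ i ∈ F := by
  classical
  simp [Finsupp.finsetSum_apply, Finsupp.single_apply]

lemma sum_single_le_iff (F : Finset σ) (m : σ →₀ ℕ) :
    ∑ j ∈ F, Finsupp.single j 1 ≤ m ↔ ∀ i ∈ F, m i ≠ 0 := by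
  classical
  simp only [Finsupp.le_def, Finsupp.finsetSum_apply, Finsupp.single_apply,
    Finset.sum_ite_eq']
  refine forall_congr' fun i => ?_
  by_cases h : i ∈ F <;> simp [h, Nat.one_le_iff_ne_zero]

lemma mem_span_squarefreeMonomial {S : Set (Finset σ)} {p : MvPolynomial σ k} :
    p ∈ Ideal.span (squarefreeMonomial k '' S) ↔
      ∀ m ∈ p.support, ∃ F ∈ S, ∀ i ∈ F, m i ≠ 0 := by
  have : squarefreeMonomial k '' S = (fun s => monomial s (1 : k)) ''
      ((fun F : Finset σ => ∑ i ∈ F, Finsupp.single i 1) '' S) := by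
    rw [Set.image_image]
    exact Set.image_congr fun F _ => squarefreeMonomial_eq_monomial F
  rw [this, mem_ideal_span_monomial_image]
  simp only [Set.exists_mem_image, sum_single_le_iff]

lemma squarefreeMonomial_mem_span {S : Set (Finset σ)} {A : Finset σ} :
    squarefreeMonomial k A ∈ Ideal.span (squarefreeMonomial k '' S) ↔ ∃ F ∈ S, F ⊆ A := by
  classical
  rw [mem_span_squarefreeMonomial, squarefreeMonomial_eq_monomial, support_monomial,
    if_neg one_ne_zero]
  simp only [Finset.mem_singleton, forall_eq, sum_single_apply_ne_zero]
  rfl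

/-- Describes the colon ideal by the monomial of `A`: only the part of `F` outside `A` has to divide
`m`. -/
lemma mul_squarefreeMonomial_mem_span {S : Set (Finset σ)} {A : Finset σ}
    {r : MvPolynomial σ k} :
    r * squarefreeMonomial k A ∈ Ideal.span (squarefreeMonomial k '' S) ↔
      ∀ m ∈ r.support, ∃ F ∈ S, ∀ i ∈ F, i ∉ A → m i ≠ 0 := by
  classical
  rw [mem_span_squarefreeMonomial, squarefreeMonomial_eq_monomial]
  have key : ∀ (m : σ →₀ ℕ) (i : σ), (m + ∑ j ∈ A, Finsupp.single j 1 : σ →₀ ℕ) i ≠ 0 ↔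
      (i ∉ A → m i ≠ 0) := fun m i => by
    have := sum_single_apply_ne_zero A i
    rw [Finsupp.add_apply]
    by_cases h : i ∈ A
    · exact iff_of_true (fun h0 => this.mpr h (Nat.eq_zero_of_add_eq_zero_left h0))
        fun hA => absurd h hA
    · simp only [not_not.mp (mt this.mp h), add_zero, h, not_false_eq_true, forall_const]
  constructor
  · intro h m hm
    obtain ⟨F, hF, hi⟩ := h (m + ∑ j ∈ A, Finsupp.single j 1) (by
      rw [mem_support_iff, coeff_mul_monomial, mul_one]
      exact mem_support_iff.mp hm)
    exact ⟨F, hF, fun i hiF => (key m i).mp (hi i hiF)⟩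
  · intro h m hm
    rw [mem_support_iff, coeff_mul_monomial', mul_one] at hm
    split_ifs at hm with hle
    · obtain ⟨F, hF, hi⟩ := h _ (mem_support_iff.mpr hm)
      refine ⟨F, hF, fun i hiF => ?_⟩
      have := (key _ i).mpr (hi i hiF)
      rwa [tsub_add_cancel_of_le hle] at this
    · exact absurd rfl hm

lemma const_mem_span_image_iff {ι : Type*} {f : ι → MvPolynomial σ k} {S : Set ι}
    {a : MvPolynomial σ k} :
    (fun _ : PUnit.{u + 1} => a) ∈ Submodule.span (MvPolynomial σ k)
        ((fun (i : ι) (_ : PUnit.{u + 1}) => f i) '' S) ↔ a ∈ Ideal.span (f '' S) := by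
  let φ := LinearEquiv.funUnique PUnit.{u + 1} (MvPolynomial σ k) (MvPolynomial σ k)
  have h : Ideal.span (f '' S) = (Submodule.span (MvPolynomial σ k)
      ((fun (i : ι) (_ : PUnit.{u + 1}) => f i) '' S)).map φ.toLinearMap := by
    rw [Submodule.map_span, Set.image_image]
    rfl
  rw [h]
  constructor
  · intro ha
    exact ⟨_, ha, rfl⟩
  · rintro ⟨w, hw, rfl⟩
    exact hw

/-- An ideal generated by square-free monomials of one positive degree with linear quotients has a
linear resolution. -/
theorem HasLinearQuotients.hasLinearResolution [Finite σ] [DecidableEq σ] {𝒜 : Set (Finset σ)}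
    (h : HasLinearQuotients 𝒜) {j : ℕ} (hj : 0 < j) (hcard : ∀ A ∈ 𝒜, A.card = j) :
    HasLinearResolution (Ideal.span (squarefreeMonomial k '' 𝒜)) := by
  classical
  obtain ⟨ρ, -, hinj, -, hex⟩ := h.exists_rank
  let : LinearOrder 𝒜 := LinearOrder.lift' (fun A => ρ A) hinj.injective
  let L : LinearStage σ k :=
    { row := PUnit.{u + 1}
      col := 𝒜
      fintypeCol := Fintype.ofFinite _
      e := j
      vec := fun A _ => squarefreeMonomial k (A : Finset σ)
      vars := fun A => {s | s ∉ (A : Finset σ) ∧ ∃ t ∈ (A : Finset σ),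
        insert s ((A : Finset σ).erase t) ∈ 𝒜 ∧ ρ (insert s ((A : Finset σ).erase t)) < ρ A}
      homogeneous := fun A _ => hcard A A.2 ▸ isHomogeneous_squarefreeMonomial _
      colon := fun A r => by
        refine (const_mem_span_image_iff (a := r * squarefreeMonomial k (A : Finset σ))).trans ?_
        rw [← Set.image_image (squarefreeMonomial k) Subtype.val,
          mul_squarefreeMonomial_mem_span, mem_ideal_span_X_image]
        refine forall₂_congr fun m _ => ?_
        constructor
        · rintro ⟨_, ⟨B, hB, rfl⟩, hm⟩
          -- The exchange property supplies a variable of the colon ideal dividing the generator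
          -- contributed by `B`.
          obtain ⟨s, hs, hsA, t, ht⟩ := hex A A.2 B B.2 hB
          exact ⟨s, ⟨hsA, t, ht⟩, hm s hs hsA⟩
        · rintro ⟨s, ⟨hsA, t, ht, hmem, hρ⟩, hm⟩
          refine ⟨_, ⟨⟨_, hmem⟩, hρ, rfl⟩, fun i hi hiA => ?_⟩
          rcases Finset.mem_insert.mp hi with rfl | hi
          · exact hm
          · exact absurd (Finset.mem_of_mem_erase hi) hiA }
  have : Unique L.row := inferInstanceAs (Unique PUnit)
  refine hasLinearResolution_of_linearStage _ L hj ?_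
  rw [Set.image_eq_range]

/-- Facets form an antichain, so none of their monomials is a redundant generator. -/
lemma facets_facetComplex_facetIdeal (Δ : SimplicialComplex σ) :
    {F | Minimal (fun G => squarefreeMonomial k G ∈ facetIdeal k Δ) F} = Δ.facets := by
  ext F
  simp only [facetIdeal, squarefreeMonomial_mem_span, Set.mem_ofPred_eq]
  constructor
  · rintro ⟨⟨G, hG, hGF⟩, hmin⟩
    rwa [(hmin ⟨G, hG, subset_rfl⟩ hGF).antisymm hGF]
  · intro hF
    refine ⟨⟨F, hF, subset_rfl⟩, ?_⟩
    rintro E ⟨G, hG, hGE⟩ hEF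
    rwa [← Δ.isAntichain_facets.eq hG hF (hGE.trans hEF)]

lemma squarefreeMonomial_mem_dualIdeal_facetIdeal (Δ : SimplicialComplex σ)
    (A : Finset σ) : squarefreeMonomial k A ∈ dualIdeal (facetIdeal k Δ) ↔
      ∀ F ∈ Δ.facets, ∃ x ∈ A, x ∈ F := by
  rw [dualIdeal, facetIdeal, squarefreeMonomial_mem_span, facetComplex,
    facets_facetComplex_facetIdeal]
  exact SimplicialComplex.exists_facet_coverComplex_subset_iff Δ.isAntichain_facets A

end SquarefreeIdeals

end FacetTree

theorem mainTheorem3 {σ : Type*} [Finite σ] {k : Type*} [Field k]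
    (Δ : FacetTree.SimplicialComplex σ) (hΔ : Δ.IsForest) :
    FacetTree.IsComponentwiseLinear (FacetTree.dualIdeal (FacetTree.facetIdeal k Δ)) := by
  classical
  intro j hj
  have : Fintype σ := Fintype.ofFinite σ
  have hfin : Δ.facets.Finite := Set.toFinite _
  have h := (hΔ.isForestFamily hfin).hasLinearQuotients_covers Finset.univ j
  have heq : FacetTree.covers Finset.univ hfin.toFinset j = {F | F.card = j ∧
      FacetTree.squarefreeMonomial k F ∈ FacetTree.dualIdeal (FacetTree.facetIdeal k Δ)} := by
    ext A
    simp [FacetTree.covers, FacetTree.squarefreeMonomial_mem_dualIdeal_facetIdeal]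
  rw [FacetTree.squarefreeComponent, ← heq]
  exact h.hasLinearResolution hj fun A hA => hA.2.1
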